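/- Let $M\in\mathbb{R}^{m\times n}$ be entrywise nonnegative and suppose that $M^TM$ is irreducible, that is, the directed graph on $\{1,\dots,n\}$ with an edge $i\to j$ whenever $(M^TM)_{ij}\neq 0$ is strongly connected (every vertex is reachable from every other vertex). Let $r\ge 0$ be any integer. The rank-$r$ semi-NMF problem for $M$ is $$\min_{U\in\mathbb{R}^{m\times r},\ V\in\mathbb{R}^{r\times n}}\ \|M-UV\|_F^2\quad\text{such that } V\ge 0 \text{ entrywise}.\qquad (*)$$ A best rank-$r$ approximation of $M$ is a minimizer of $\|M-X\|_F^2$ over all $X\in\mathbb{R}^{m\times n}$ with $\operatorname{rank}X\le r$. A matrix $X$ is semi-nonnegative if $\operatorname{rank}X$ equals the smallest $k$ such that $X=UV$ for some $U\in\mathbb{R}^{m\times k}$ and some entrywise nonnegative $V\in\mathbb{R}^{k\times n}$. A rank-$r$ truncated SVD of $M$ is a triple $(A,S,B)$ with $A\in\mathbb{R}^{m\times r}$, $B\in\mathbb{R}^{r\times n}$, $A^TA=BB^T=I_r$, $MB^T=AS$ and $M^TA=B^TS$, where $S$ is the diagonal matrix of the $r$ largest singular values of $M$ in nonincreasing order.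 Then semi-NMF is solved via the truncated SVD, in the following sense. 1. A best rank-$r$ approximation of $M$ exists. Every best rank-$r$ approximation $X$ of $M$ is semi-nonnegative, its row space contains an entrywise positive vector if $r\ge 1$ and $M\ne 0$, and $X=UV$ for some optimal solution $(U,V)$ of $(*)$. 2. If $r\le\min(m,n)$, then $M$ has a rank-$r$ truncated SVD. For every rank-$r$ truncated SVD $(A,S,B)$ of $M$, the matrix $ASB$ is a best rank-$r$ approximation of $M$. Let $\tilde B$ be obtained from $B$ by multiplying by $-1$ each row $B(i,:)$ with $\min_j B(i,j)\le \min_j(-B(i,j))$. For $y\in\mathbb{R}^r$ with $x=\tilde B^Ty\ge 1$ (entrywise), put $\alpha_i=\max\bigl(0,\max_j(-\tilde B(i,j)/x_j)\bigr)$ for $1\le i\le r$ and $V=\tilde B+\alpha x^T$. If $r\ge 1$, there is such a $y$ that also satisfies $1+y^T\alpha\ne 0$. For every $y\in\mathbb{R}^r$ with $\tilde B^Ty\ge 1$ and $1+y^T\alpha\neq 0$, some $U\in\mathbb{R}^{m\times r}$ satisfies $UV=ASB$, and for every minimizer $U$ of $\|M-UV\|_F^2$ over $\mathbb{R}^{m\times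 r}$ (with $V$ fixed) the pair $(U,V)$ is an optimal solution of $(*)$. -/

import Mathlib

open Matrix
open scoped Matrix.Norms.Frobenius

namespace SemiNMF

/-- A square matrix is irreducible if its directed graph, with an edge from `i` to `j` whenever
`A i j ≠ 0`, is strongly connected: every vertex is reachable from every other vertex. -/
def IsIrreducible {n : ℕ} (A : Matrix (Fin n) (Fin n) ℝ) : Prop :=
  ∀ i j, Relation.ReflTransGen (fun k l => A k l ≠ 0) i j

/-- `(U, V)` is an optimal solution of the semi-NMF problem
`min ‖M - U V‖_F²` over `U ∈ ℝ^{m × r}` and `V ∈ ℝ^{r × n}` with `V ≥ 0`. -/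
def IsSolution {m n r : ℕ} (M : Matrix (Fin m) (Fin n) ℝ)
    (U : Matrix (Fin m) (Fin r) ℝ) (V : Matrix (Fin r) (Fin n) ℝ) : Prop :=
  (∀ i j, 0 ≤ V i j) ∧
    ∀ (U' : Matrix (Fin m) (Fin r) ℝ) (V' : Matrix (Fin r) (Fin n) ℝ),
      (∀ i j, 0 ≤ V' i j) → ‖M - U * V‖ ^ 2 ≤ ‖M - U' * V'‖ ^ 2

/-- The semi-nonnegative rank: the smallest `r` such that `M = U V` for some
`U ∈ ℝ^{m × r}` and some nonnegative `V ∈ ℝ^{r × n}`. -/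
noncomputable def semiNonnegRank {m n : ℕ} (M : Matrix (Fin m) (Fin n) ℝ) : ℕ :=
  sInf {r : ℕ | ∃ (U : Matrix (Fin m) (Fin r) ℝ) (V : Matrix (Fin r) (Fin n) ℝ),
    (∀ i j, 0 ≤ V i j) ∧ M = U * V}

/-- A matrix is semi-nonnegative if its rank equals its semi-nonnegative rank. -/
def IsSemiNonneg {m n : ℕ} (M : Matrix (Fin m) (Fin n) ℝ) : Prop :=
  M.rank = semiNonnegRank M

/-- `X` is a best rank-`r` approximation of `M`: an optimal solution of
`min ‖M - X‖_F²` over the matrices `X` of rank at most `r`. -/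
def IsBestApprox {m n : ℕ} (M : Matrix (Fin m) (Fin n) ℝ) (r : ℕ)
    (X : Matrix (Fin m) (Fin n) ℝ) : Prop :=
  X.rank ≤ r ∧ ∀ Y : Matrix (Fin m) (Fin n) ℝ, Y.rank ≤ r → ‖M - X‖ ^ 2 ≤ ‖M - Y‖ ^ 2

/-- The diagonal matrix of the `r` largest singular values of `M`, in nonincreasing order and
with multiplicity. -/
noncomputable def singularDiag {m n : ℕ} (M : Matrix (Fin m) (Fin n) ℝ) (r : ℕ) :
    Matrix (Fin r) (Fin r) ℝ :=
  Matrix.diagonal fun i => (Matrix.toEuclideanLin M).singularValues (i : ℕ)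

/-- `(A, S, B)` with `S = singularDiag M r` is a rank-`r` truncated singular value decomposition
of `M`: the columns of `A` and the rows of `B` are orthonormal systems of left and right singular
vectors of `M` for its `r` largest singular values. -/
structure IsTruncatedSVD {m n r : ℕ} (M : Matrix (Fin m) (Fin n) ℝ)
    (A : Matrix (Fin m) (Fin r) ℝ) (B : Matrix (Fin r) (Fin n) ℝ) : Prop where
  left_orthonormal : Aᵀ * A = 1
  right_orthonormal : B * Bᵀ = 1
  mul_right : M * Bᵀ = A * singularDiag M r
  transpose_mul_left : Mᵀ * A = Bᵀ * singularDiag M r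

open Classical in
/-- Multiply the row `B(i,:)` by `-1` whenever `min_j B(i,j) ≤ min_j (-B(i,j))`. -/
noncomputable def signFlip {r n : ℕ} (B : Matrix (Fin r) (Fin n) ℝ) :
    Matrix (Fin r) (Fin n) ℝ :=
  Matrix.of fun i j => if (⨅ k, B i k) ≤ (⨅ k, -B i k) then -B i j else B i j

/-- The coefficients `α_i = max (0, max_j (-B(i,j) / x(j)))`, where `x = Bᵀ y`. -/
noncomputable def shift {r n : ℕ} (B : Matrix (Fin r) (Fin n) ℝ) (y : Fin r → ℝ) : Fin r → ℝ :=
  fun i => max 0 (⨆ j, -B i j / (y ᵥ* B) j)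

/-- The matrix `V = B + α xᵀ`, where `x = Bᵀ y`. -/
noncomputable def shifted {r n : ℕ} (B : Matrix (Fin r) (Fin n) ℝ) (y : Fin r → ℝ) :
    Matrix (Fin r) (Fin n) ℝ :=
  B + Matrix.vecMulVec (shift B y) (y ᵥ* B)

end SemiNMF

/-! The rank bound alone gives a lower bound for (*), so it suffices to factor a best rank-`r`
approximation `X` with a nonnegative right factor (`IsBestApprox.isSolution`). This is possible once
the row space of `X` contains a positive vector `x`: adding multiples of `x` to the rows of a basis
makes them nonnegative, and the row space survives if the rank-one update is invertible
(`exists_mul_add_vecMulVec_eq`).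

The positive vector comes from Perron–Frobenius for the Gram matrix `G = Mᵀ * M`: eigenvectors for
its largest eigenvalue have one strict sign and span a line. Optimality of `X` makes `Xᵀ * X`
commute with `G`, so it maps the Perron vector `v` to a top eigenvector lying in the row space. That
image is nonzero because an exchange argument shows `X *ᵥ v ≠ 0` (`IsBestApprox.mulVec_ne_zero`).

For a truncated SVD, optimality is Eckart–Young, and the first row of `B` is itself a top
eigenvector of `G`. -/

namespace SemiNMF

/-! ### Frobenius norm and orthogonal projection -/

section Frobenius

variable {l m n k : Type*} [Fintype l] [Fintype m] [Fintype n] [Fintype k]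

lemma norm_sq_eq_trace (A : Matrix m n ℝ) : ‖A‖ ^ 2 = trace (Aᵀ * A) := by
  rw [frobenius_norm_def, ← Real.sqrt_eq_rpow, Real.sq_sqrt (by positivity)]
  simp only [trace, diag, mul_apply, transpose_apply]
  rw [Finset.sum_comm]
  refine Finset.sum_congr rfl fun i _ => Finset.sum_congr rfl fun j _ => ?_
  rw [Real.rpow_two, Real.norm_eq_abs, sq_abs, sq]

lemma transpose_mul_self_apply_nonneg {m n : Type*} [Fintype m] (A : Matrix m n ℝ) (i : n) :
    0 ≤ (Aᵀ * A) i i := by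
  rw [mul_apply]
  exact Finset.sum_nonneg fun a _ => mul_self_nonneg (A a i)

lemma norm_sq_sub (A B : Matrix m n ℝ) :
    ‖A - B‖ ^ 2 = ‖A‖ ^ 2 - 2 * trace (Aᵀ * B) + ‖B‖ ^ 2 := by
  have h : trace (Bᵀ * A) = trace (Aᵀ * B) := by
    rw [← trace_transpose, transpose_mul, transpose_transpose]
  simp only [norm_sq_eq_trace, transpose_sub, Matrix.sub_mul, Matrix.mul_sub, trace_sub, h]
  ring

/-- Pythagoras: among matrices with rows in the span of `Q`, the closest to `M` is `M * Qᵀ * Q`. -/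
lemma norm_sq_sub_mul [DecidableEq k] (M : Matrix m n ℝ) (Z : Matrix m k ℝ) {Q : Matrix k n ℝ}
    (hQ : Q * Qᵀ = 1) :
    ‖M - Z * Q‖ ^ 2 = ‖M‖ ^ 2 - ‖M * Qᵀ‖ ^ 2 + ‖M * Qᵀ - Z‖ ^ 2 := by
  have h1 : trace (Mᵀ * (Z * Q)) = trace ((M * Qᵀ)ᵀ * Z) := by
    rw [transpose_mul, transpose_transpose, Matrix.mul_assoc, trace_mul_comm, Matrix.mul_assoc,
      trace_mul_comm, Matrix.mul_assoc]
  have h2 : ‖Z * Q‖ ^ 2 = ‖Z‖ ^ 2 := by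
    rw [norm_sq_eq_trace, norm_sq_eq_trace, transpose_mul, Matrix.mul_assoc, trace_mul_comm,
      Matrix.mul_assoc, Matrix.mul_assoc, hQ, Matrix.mul_one]
  rw [norm_sq_sub, norm_sq_sub, h1, h2]
  ring

lemma norm_sq_mul_transpose (M : Matrix m n ℝ) (Q : Matrix k n ℝ) :
    ‖M * Qᵀ‖ ^ 2 = ∑ i, (M *ᵥ Q i) ⬝ᵥ (M *ᵥ Q i) := by
  rw [norm_sq_eq_trace]
  rfl

end Frobenius

/-- `Q` is an orthonormal basis of the row space. The factor `W` is what later turns `X *ᵥ v = 0`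
into `Q *ᵥ v = 0`. -/
lemma exists_orthonormal_rows {m n : ℕ} (Y : Matrix (Fin m) (Fin n) ℝ) :
    ∃ Q : Matrix (Fin Y.rank) (Fin n) ℝ, Q * Qᵀ = 1 ∧ Y = Y * Qᵀ * Q ∧
      ∃ W : Matrix (Fin Y.rank) (Fin m) ℝ, Q = W * Y := by
  set R : Submodule ℝ (EuclideanSpace ℝ (Fin n)) := (toEuclideanLin Yᵀ).range with hR
  have hdim : Module.finrank ℝ R = Y.rank := by
    rw [← rank_transpose Y, rank_eq_finrank_range_toLin Yᵀ
      (EuclideanSpace.basisFun (Fin n) ℝ).toBasis (EuclideanSpace.basisFun (Fin m) ℝ).toBasis]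
    rfl
  let b := (stdOrthonormalBasis ℝ R).reindex (finCongr hdim)
  let Q : Matrix (Fin Y.rank) (Fin n) ℝ := of fun i j => (b i : EuclideanSpace ℝ (Fin n)) j
  have hinner : ∀ x y : EuclideanSpace ℝ (Fin n), inner ℝ x y = ∑ j, x j * y j := by
    intro x y
    simp [PiLp.inner_apply, mul_comm]
  have hQ : Q * Qᵀ = 1 := by
    ext i j
    have := orthonormal_iff_ite.1 b.orthonormal i j
    rw [Submodule.coe_inner, hinner] at this
    simpa [Q, mul_apply, one_apply] using this
  refine ⟨Q, hQ, ?_, ?_⟩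
  · ext i j
    let y : R := ⟨WithLp.toLp 2 (Y i), by
      rw [hR]
      refine ⟨EuclideanSpace.single i 1, ?_⟩
      ext j
      simp [toLpLin_apply]⟩
    have h := b.sum_repr' y
    have h2 : (∑ a, inner ℝ (b a) y • (b a : EuclideanSpace ℝ (Fin n))) j = Y i j := by
      have := congrArg (fun z : R => (z : EuclideanSpace ℝ (Fin n)) j) h
      simpa [y] using this
    rw [← h2, mul_apply]
    simp only [WithLp.ofLp_sum, Finset.sum_apply, PiLp.smul_apply, smul_eq_mul]
    refine Finset.sum_congr rfl fun a _ => ?_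
    rw [Submodule.coe_inner, hinner]
    congr 1
    simp [y, Q, mul_apply, mul_comm]
  · have : ∀ i, ∃ w : EuclideanSpace ℝ (Fin m), toEuclideanLin Yᵀ w = b i := fun i => (b i).2
    choose w hw using this
    refine ⟨of fun i j => w i j, ?_⟩
    ext i j
    have := congrArg (fun z : EuclideanSpace ℝ (Fin n) => z j) (hw i)
    simp only [toLpLin_apply, mulVec, dotProduct, transpose_apply] at this
    simp only [Q, of_apply, mul_apply, ← this]
    exact Finset.sum_congr rfl fun a _ => mul_comm _ _

/-! ### Perron–Frobenius for symmetric nonnegative matrices -/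

section Perron

variable {n : ℕ} {G : Matrix (Fin n) (Fin n) ℝ} {c : ℝ}

/-- `c • 1 - G` is positive semidefinite, and such a form vanishes only on the kernel. -/
lemma mulVec_eq_of_rayleigh_eq (hG : Gᵀ = G) (hmax : ∀ x, x ⬝ᵥ G *ᵥ x ≤ c * (x ⬝ᵥ x))
    {x : Fin n → ℝ} (hx : x ⬝ᵥ G *ᵥ x = c * (x ⬝ᵥ x)) : G *ᵥ x = c • x := by
  have key : ∀ y : Fin n → ℝ, star y ⬝ᵥ ((c • (1 : Matrix (Fin n) (Fin n) ℝ) - G) *ᵥ y)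
      = c * (y ⬝ᵥ y) - y ⬝ᵥ G *ᵥ y := by
    intro y
    simp [sub_mulVec, smul_mulVec, dotProduct_sub]
  have hpsd : (c • (1 : Matrix (Fin n) (Fin n) ℝ) - G).PosSemidef := by
    refine PosSemidef.of_dotProduct_mulVec_nonneg ?_ fun y => ?_
    · rw [IsHermitian, conjTranspose_eq_transpose_of_trivial]
      simp [hG]
    · rw [key]
      linarith [hmax y]
  have := (hpsd.dotProduct_mulVec_zero_iff x).1 (by rw [key]; linarith)
  rw [sub_mulVec, smul_mulVec, one_mulVec, sub_eq_zero] at this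
  exact this.symm

/-- Taking absolute values preserves the norm and, as `G` is nonnegative, cannot lower the quadratic
form; so `|x|` is again extremal. -/
lemma mulVec_abs_eq (hG : Gᵀ = G) (hpos : ∀ i j, 0 ≤ G i j)
    (hmax : ∀ x, x ⬝ᵥ G *ᵥ x ≤ c * (x ⬝ᵥ x)) {x : Fin n → ℝ} (hx : G *ᵥ x = c • x) :
    G *ᵥ |x| = c • |x| := by
  refine mulVec_eq_of_rayleigh_eq hG hmax (le_antisymm (hmax _) ?_)
  have h1 : |x| ⬝ᵥ |x| = x ⬝ᵥ x := by simp [dotProduct]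
  have h2 : c * (x ⬝ᵥ x) = x ⬝ᵥ G *ᵥ x := by rw [hx, dotProduct_smul, smul_eq_mul]
  rw [h1, h2]
  simp only [dotProduct, mulVec, Finset.mul_sum, Pi.abs_apply]
  refine Finset.sum_le_sum fun i _ => Finset.sum_le_sum fun j _ => ?_
  calc x i * (G i j * x j) ≤ |x i * (G i j * x j)| := le_abs_self _
    _ = _ := by rw [abs_mul, abs_mul, abs_of_nonneg (hpos i j)]

lemma pos_of_mulVec_eq (hpos : ∀ i j, 0 ≤ G i j) (hirr : IsIrreducible G) {x : Fin n → ℝ}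
    (hx0 : ∀ i, 0 ≤ x i) (hne : x ≠ 0) (hx : G *ᵥ x = c • x) (i : Fin n) : 0 < x i := by
  obtain ⟨j, hj⟩ := Function.ne_iff.1 hne
  have hj : 0 < x j := lt_of_le_of_ne (hx0 j) (Ne.symm hj)
  -- Positivity spreads backwards along edges: if `G a b` and `x b` are positive, then `c * x a` is
  -- positive, so `x a ≠ 0`.
  refine Relation.ReflTransGen.head_induction_on (hirr i j) hj ?_
  intro a b hab _ hb
  have h := congrFun hx a
  simp only [mulVec, dotProduct, Pi.smul_apply, smul_eq_mul] at h
  have hab : 0 < G a b := lt_of_le_of_ne (hpos a b) (Ne.symm hab)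
  have h3 : 0 < ∑ i, G a i * x i :=
    Finset.sum_pos' (fun i _ => mul_nonneg (hpos a i) (hx0 i))
      ⟨b, Finset.mem_univ _, mul_pos hab hb⟩
  refine lt_of_le_of_ne (hx0 a) fun h0 => ?_
  rw [h, ← h0, mul_zero] at h3
  exact h3.false

lemma abs_pos_of_mulVec_eq (hG : Gᵀ = G) (hpos : ∀ i j, 0 ≤ G i j) (hirr : IsIrreducible G)
    (hmax : ∀ x, x ⬝ᵥ G *ᵥ x ≤ c * (x ⬝ᵥ x)) {x : Fin n → ℝ} (hne : x ≠ 0)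
    (hx : G *ᵥ x = c • x) (i : Fin n) : 0 < |x i| :=
  pos_of_mulVec_eq (x := |x|) hpos hirr (fun _ => abs_nonneg _) (by simpa using hne)
    (mulVec_abs_eq hG hpos hmax hx) i

lemma exists_smul_of_mulVec_eq (hG : Gᵀ = G) (hpos : ∀ i j, 0 ≤ G i j) (hirr : IsIrreducible G)
    (hmax : ∀ x, x ⬝ᵥ G *ᵥ x ≤ c * (x ⬝ᵥ x)) {u v : Fin n → ℝ} (hv : ∀ i, 0 < v i)
    (hGv : G *ᵥ v = c • v) (hGu : G *ᵥ u = c • u) : ∃ t : ℝ, u = t • v := by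
  rcases n.eq_zero_or_pos with rfl | hn
  · exact ⟨0, Subsingleton.elim _ _⟩
  let i : Fin n := ⟨0, hn⟩
  -- This multiple cancels coordinate `i`, while a nonzero top eigenvector vanishes nowhere.
  refine ⟨u i / v i, ?_⟩
  by_contra hne
  have hne' : u - (u i / v i) • v ≠ 0 := sub_ne_zero.2 hne
  have := abs_pos_of_mulVec_eq hG hpos hirr hmax hne'
    (by rw [mulVec_sub, mulVec_smul, hGv, hGu, smul_sub, smul_comm]) i
  simp [div_mul_cancel₀ _ (hv i).ne'] at this

lemma rayleigh_lt_of_dotProduct_eq_zero (hG : Gᵀ = G) (hpos : ∀ i j, 0 ≤ G i j)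
    (hirr : IsIrreducible G) (hmax : ∀ x, x ⬝ᵥ G *ᵥ x ≤ c * (x ⬝ᵥ x)) {v w : Fin n → ℝ}
    (hv : ∀ i, 0 < v i) (hGv : G *ᵥ v = c • v) (hw : w ≠ 0) (hwv : w ⬝ᵥ v = 0) :
    w ⬝ᵥ G *ᵥ w < c * (w ⬝ᵥ w) := by
  refine lt_of_le_of_ne (hmax w) fun h => ?_
  obtain ⟨t, ht⟩ := exists_smul_of_mulVec_eq hG hpos hirr hmax hv hGv
    (mulVec_eq_of_rayleigh_eq hG hmax h)
  have h2 : w ⬝ᵥ w = 0 := by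
    nth_rw 2 [ht]
    rw [dotProduct_smul, hwv, smul_zero]
  exact hw (dotProduct_self_eq_zero.1 h2)

lemma pos_or_neg_of_mulVec_eq (hG : Gᵀ = G) (hpos : ∀ i j, 0 ≤ G i j) (hirr : IsIrreducible G)
    (hmax : ∀ x, x ⬝ᵥ G *ᵥ x ≤ c * (x ⬝ᵥ x)) {u : Fin n → ℝ} (hu : u ≠ 0)
    (hGu : G *ᵥ u = c • u) : (∀ i, 0 < u i) ∨ ∀ i, u i < 0 := by
  have habs := abs_pos_of_mulVec_eq hG hpos hirr hmax hu hGu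
  obtain ⟨t, ht⟩ := exists_smul_of_mulVec_eq (v := |u|) hG hpos hirr hmax habs
    (mulVec_abs_eq hG hpos hmax hGu) hGu
  rcases lt_trichotomy t 0 with h | h | h
  · right
    intro i
    rw [ht]
    exact mul_neg_of_neg_of_pos h (habs i)
  · rw [h, zero_smul] at ht
    exact absurd ht hu
  · left
    intro i
    rw [ht]
    exact mul_pos h (habs i)

end Perron

/-- The singular values of a matrix, in nonincreasing order. -/
noncomputable abbrev sv {m n : ℕ} (M : Matrix (Fin m) (Fin n) ℝ) (i : ℕ) : ℝ :=
  (Matrix.toEuclideanLin M).singularValues i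

/-! ### Singular values and the Ky Fan bound -/

section Spectral

variable {m n : ℕ} (M : Matrix (Fin m) (Fin n) ℝ)

lemma exists_right_singular_basis :
    ∃ B : Matrix (Fin n) (Fin n) ℝ, B * Bᵀ = 1 ∧ ∀ i, (Mᵀ * M) *ᵥ B i = sv M i ^ 2 • B i := by
  set T := toEuclideanLin M with hT
  have hn : Module.finrank ℝ (EuclideanSpace ℝ (Fin n)) = n := finrank_euclideanSpace_fin
  obtain ⟨b, hb⟩ : ∃ b : OrthonormalBasis (Fin n) ℝ (EuclideanSpace ℝ (Fin n)), ∀ i,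
      (LinearMap.adjoint T ∘ₗ T) (b i) =
        (T.isSymmetric_adjoint_comp_self.eigenvalues hn i : ℝ) • b i :=
    ⟨_, T.isSymmetric_adjoint_comp_self.apply_eigenvectorBasis hn⟩
  refine ⟨of fun i j => b i j, ?_, fun i => ?_⟩
  · ext i j
    rw [one_apply, ← orthonormal_iff_ite.1 b.orthonormal i j, PiLp.inner_apply, mul_apply]
    exact Finset.sum_congr rfl fun a _ => mul_comm (b i a : ℝ) (b j a)
  · have h := hb i
    rw [← T.sq_singularValues_fin hn, hT, ← toEuclideanLin_conjTranspose_eq_adjoint] at h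
    have h2 := congrArg (fun z : EuclideanSpace ℝ (Fin n) => z.ofLp) h
    simp only [LinearMap.comp_apply, toLpLin_apply, mulVec_mulVec,
      conjTranspose_eq_transpose_of_trivial] at h2
    exact h2

variable {M}

lemma gram_eq_of_basis {B : Matrix (Fin n) (Fin n) ℝ} (hB : B * Bᵀ = 1)
    (h : ∀ i, (Mᵀ * M) *ᵥ B i = sv M i ^ 2 • B i) :
    Mᵀ * M = Bᵀ * diagonal (fun i : Fin n => sv M i ^ 2) * B := by
  have h1 : (Mᵀ * M) * Bᵀ = Bᵀ * diagonal (fun i : Fin n => sv M i ^ 2) := by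
    ext i j
    have := congrFun (h j) i
    rw [mul_diagonal, mul_comm]
    exact this
  rw [← h1, Matrix.mul_assoc, mul_eq_one_comm.1 hB, Matrix.mul_one]

lemma dotProduct_gram (x : Fin n → ℝ) : x ⬝ᵥ (Mᵀ * M) *ᵥ x = (M *ᵥ x) ⬝ᵥ (M *ᵥ x) := by
  rw [← mulVec_mulVec, dotProduct_mulVec, vecMul_transpose]

lemma rayleigh_le (x : Fin n → ℝ) : x ⬝ᵥ (Mᵀ * M) *ᵥ x ≤ sv M 0 ^ 2 * (x ⬝ᵥ x) := by
  obtain ⟨B, hB, h⟩ := exists_right_singular_basis M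
  have hx : x ⬝ᵥ x = (B *ᵥ x) ⬝ᵥ (B *ᵥ x) := by
    rw [← dotProduct_gram, mul_eq_one_comm.1 hB, one_mulVec]
  rw [gram_eq_of_basis hB h, hx, ← mulVec_mulVec, ← mulVec_mulVec, dotProduct_mulVec,
    vecMul_transpose]
  simp only [dotProduct, mulVec_diagonal, Finset.mul_sum]
  refine Finset.sum_le_sum fun i _ => ?_
  have h1 : sv M i ^ 2 ≤ sv M 0 ^ 2 :=
    pow_le_pow_left₀ (LinearMap.singularValues_nonneg _ _)
      (LinearMap.singularValues_antitone _ (Nat.zero_le _)) 2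
  nlinarith [mul_self_nonneg ((B *ᵥ x) i)]

/-- In a singular basis the left side is a sum of squared singular values with weights in `[0, 1]`
of total `k`, so it is largest when the weight sits on the top ones. -/
lemma norm_sq_mul_transpose_le {k r : ℕ} (hkr : k ≤ r) {Q : Matrix (Fin k) (Fin n) ℝ}
    (hQ : Q * Qᵀ = 1) : ‖M * Qᵀ‖ ^ 2 ≤ ∑ i ∈ Finset.range r, sv M i ^ 2 := by
  obtain ⟨B, hB, h⟩ := exists_right_singular_basis M
  set R := Q * Bᵀ with hR
  have hRR : R * Rᵀ = 1 := by
    rw [hR, transpose_mul, transpose_transpose, Matrix.mul_assoc, ← Matrix.mul_assoc Bᵀ,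
      mul_eq_one_comm.1 hB, Matrix.one_mul, hQ]
  set c : Fin n → ℝ := fun i => (Rᵀ * R) i i with hc
  have hc0 : ∀ i, 0 ≤ c i := fun i => transpose_mul_self_apply_nonneg R i
  have hc1 : ∀ i, c i ≤ 1 := fun i => by
    -- The complementary projection is a Gram matrix, so its diagonal is nonnegative.
    have hP : (1 - Rᵀ * R : Matrix (Fin n) (Fin n) ℝ)ᵀ * (1 - Rᵀ * R) = 1 - Rᵀ * R := by
      have : Rᵀ * R * (Rᵀ * R) = Rᵀ * R := by
        rw [Matrix.mul_assoc, ← Matrix.mul_assoc R, hRR, Matrix.one_mul]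
      simp [Matrix.mul_sub, Matrix.sub_mul, this]
    have h0 := transpose_mul_self_apply_nonneg (1 - Rᵀ * R) i
    rw [hP, Matrix.sub_apply, one_apply_eq] at h0
    linarith
  have hcs : ∑ i, c i = k := by
    have : trace (Rᵀ * R) = k := by rw [trace_mul_comm, hRR, trace_one, Fintype.card_fin]
    exact this
  have hnorm : ‖M * Qᵀ‖ ^ 2 = ∑ i : Fin n, sv M i ^ 2 * c i := by
    have h1 : trace ((M * Qᵀ)ᵀ * (M * Qᵀ)) =
        trace (diagonal (fun i : Fin n => sv M i ^ 2) * (Rᵀ * R)) := by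
      rw [hR, transpose_mul, transpose_transpose, transpose_mul, transpose_transpose,
        Matrix.mul_assoc Q, ← Matrix.mul_assoc Mᵀ, gram_eq_of_basis hB h, trace_mul_comm]
      simp only [Matrix.mul_assoc]
      rw [trace_mul_comm]
      simp only [Matrix.mul_assoc]
    rw [norm_sq_eq_trace, h1]
    simp [trace, diagonal_mul, hc]
  -- With zero-based indices, `τ` is the first square left out; it separates terms to be weighted
  -- fully from those to be dropped.
  set τ := sv M r ^ 2 with hτ
  have hmono : ∀ {i j : ℕ}, i ≤ j → sv M j ^ 2 ≤ sv M i ^ 2 := fun hij =>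
    pow_le_pow_left₀ (LinearMap.singularValues_nonneg _ _)
      (LinearMap.singularValues_antitone _ hij) 2
  have hterm : ∀ i : Fin n, sv M i ^ 2 * c i ≤
      τ * c i + (if (i : ℕ) < r then sv M i ^ 2 - τ else 0) := by
    intro i
    split_ifs with hi
    · nlinarith [hmono hi.le, hc1 i]
    · nlinarith [hmono (not_lt.1 hi), hc0 i]
  have hsum : ∑ i : Fin n, (if (i : ℕ) < r then sv M i ^ 2 - τ else 0) ≤
      ∑ i ∈ Finset.range r, (sv M i ^ 2 - τ) := by
    rw [Fin.sum_univ_eq_sum_range (fun i => if i < r then sv M i ^ 2 - τ else 0),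
      ← Finset.sum_filter]
    refine Finset.sum_le_sum_of_subset_of_nonneg ?_ ?_
    · intro i
      simp
    · intro i hi _
      linarith [hmono (Finset.mem_range.1 hi).le]
  have hkr' : (k : ℝ) ≤ r := by exact_mod_cast hkr
  calc ‖M * Qᵀ‖ ^ 2 = ∑ i : Fin n, sv M i ^ 2 * c i := hnorm
    _ ≤ ∑ i : Fin n, (τ * c i + (if (i : ℕ) < r then sv M i ^ 2 - τ else 0)) :=
        Finset.sum_le_sum fun i _ => hterm i
    _ ≤ τ * k + ∑ i ∈ Finset.range r, (sv M i ^ 2 - τ) := by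
        rw [Finset.sum_add_distrib, ← Finset.mul_sum, hcs]
        gcongr
    _ ≤ ∑ i ∈ Finset.range r, sv M i ^ 2 := by
        rw [Finset.sum_sub_distrib, Finset.sum_const, Finset.card_range, nsmul_eq_mul]
        nlinarith [sq_nonneg (sv M r)]

end Spectral

/-! ### Existence and optimality of truncated SVDs -/

section TruncatedSVD

variable {m n : ℕ} {M : Matrix (Fin m) (Fin n) ℝ}

lemma lt_of_sv_ne_zero {i : ℕ} (hi : sv M i ≠ 0) : i < m ∧ i < n := by
  have h : i < Module.finrank ℝ (toEuclideanLin M).range :=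
    LinearMap.singularValues_pos_iff_lt_finrank_range _ |>.1
      (lt_of_le_of_ne (LinearMap.singularValues_nonneg _ _) (Ne.symm hi))
  constructor
  · exact h.trans_le ((Submodule.finrank_le _).trans finrank_euclideanSpace_fin.le)
  · exact h.trans_le ((LinearMap.finrank_range_le _).trans finrank_euclideanSpace_fin.le)

lemma exists_left_singular_basis {B : Matrix (Fin n) (Fin n) ℝ} (hB : B * Bᵀ = 1)
    (h : ∀ i, (Mᵀ * M) *ᵥ B i = sv M i ^ 2 • B i) :
    ∃ C : Matrix (Fin m) (Fin m) ℝ, C * Cᵀ = 1 ∧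
      ∀ i (hm : i < m) (hn : i < n), M *ᵥ B ⟨i, hn⟩ = sv M i • C ⟨i, hm⟩ := by
  have hBB : ∀ i j, B i ⬝ᵥ B j = if i = j then 1 else 0 := fun i j => by
    rw [← one_apply, ← hB]
    rfl
  have hMB : ∀ i j, (M *ᵥ B i) ⬝ᵥ (M *ᵥ B j) = if i = j then sv M j ^ 2 else 0 := fun i j => by
    rw [dotProduct_mulVec, ← mulVec_transpose, mulVec_mulVec, h, smul_dotProduct, hBB]
    split_ifs with hij <;> simp [hij]
  let v : Fin m → EuclideanSpace ℝ (Fin m) := fun i =>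
    if hn : (i : ℕ) < n then WithLp.toLp 2 ((sv M i)⁻¹ • (M *ᵥ B ⟨i, hn⟩)) else 0
  -- Only these `v i` must be orthonormal; here `i < n`, so the default `0` in `v` is not used. For
  -- the other indices `M *ᵥ B i = 0`, and any completion works.
  let s : Set (Fin m) := {i | sv M i ≠ 0}
  have hinner : ∀ x y : EuclideanSpace ℝ (Fin m), inner ℝ x y = x.ofLp ⬝ᵥ y.ofLp := fun x y => by
    rw [EuclideanSpace.inner_eq_star_dotProduct, dotProduct_comm]
    rfl
  have hv : Orthonormal ℝ (s.domRestrict v) := by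
    rw [orthonormal_iff_ite]
    rintro ⟨i, hi⟩ ⟨j, hj⟩
    have hi' : sv M i ≠ 0 := hi
    have hj' : sv M j ≠ 0 := hj
    have hin := (lt_of_sv_ne_zero hi').2
    have hjn := (lt_of_sv_ne_zero hj').2
    simp only [Set.domRestrict_apply, v, hin, hjn, dif_pos, hinner, smul_dotProduct,
      dotProduct_smul, hMB, Subtype.mk.injEq, Fin.ext_iff]
    split_ifs with hij
    · rw [hij]
      simp only [smul_eq_mul]
      field_simp
    · simp
  obtain ⟨b, hb⟩ := hv.exists_orthonormalBasis_extension_of_card_eq (by simp)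
  refine ⟨of fun i j => b i j, ?_, fun i hm hn => ?_⟩
  · ext i j
    rw [one_apply, ← orthonormal_iff_ite.1 b.orthonormal i j, hinner]
    rfl
  · by_cases hi : sv M i = 0
    · rw [hi, zero_smul, ← dotProduct_self_eq_zero, hMB, if_pos rfl]
      simp [hi]
    · have h1 : b ⟨i, hm⟩ = v ⟨i, hm⟩ := hb _ hi
      have h2 : (of fun i j => b i j : Matrix (Fin m) (Fin m) ℝ) ⟨i, hm⟩ =
          (sv M i)⁻¹ • (M *ᵥ B ⟨i, hn⟩) := by
        have : (of fun i j => b i j : Matrix (Fin m) (Fin m) ℝ) ⟨i, hm⟩ = (b ⟨i, hm⟩).ofLp := rfl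
        rw [this, h1]
        simp [v, hn]
      rw [h2, smul_smul, mul_inv_cancel₀ hi, one_smul]

lemma exists_isTruncatedSVD (M : Matrix (Fin m) (Fin n) ℝ) {r : ℕ} (hr : r ≤ min m n) :
    ∃ (A : Matrix (Fin m) (Fin r) ℝ) (B : Matrix (Fin r) (Fin n) ℝ), IsTruncatedSVD M A B := by
  obtain ⟨B, hB, h⟩ := exists_right_singular_basis M
  obtain ⟨C, hC, hMB⟩ := exists_left_singular_basis hB h
  have hrm : r ≤ m := hr.trans (min_le_left _ _)
  have hrn : r ≤ n := hr.trans (min_le_right _ _)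
  have hCC : ∀ i j, C i ⬝ᵥ C j = if i = j then 1 else 0 := fun i j => by
    rw [← one_apply, ← hC]
    rfl
  have hBB : ∀ i j, B i ⬝ᵥ B j = if i = j then 1 else 0 := fun i j => by
    rw [← one_apply, ← hB]
    rfl
  have hMC : ∀ j : Fin r, Mᵀ *ᵥ C (Fin.castLE hrm j) = sv M j • B (Fin.castLE hrn j) := by
    intro j
    -- As `B` is orthogonal, the identity may be tested against each row of `B`, where `M *ᵥ B i` is
    -- known.
    have hinj : Function.Injective (B *ᵥ ·) :=
      Function.LeftInverse.injective (g := (Bᵀ *ᵥ ·)) fun x => by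
        simp [mulVec_mulVec, mul_eq_one_comm.1 hB]
    apply hinj
    ext i
    change B i ⬝ᵥ _ = B i ⬝ᵥ _
    rw [dotProduct_mulVec, vecMul_transpose, dotProduct_smul, hBB]
    by_cases hi : sv M i = 0
    · have h0 : M *ᵥ B i = 0 := by
        rw [← dotProduct_self_eq_zero, ← dotProduct_gram, h, hi]
        simp
      rw [h0, zero_dotProduct]
      split_ifs with hij
      · have : sv M j = 0 := by rw [← hi, hij]; rfl
        simp [this]
      · simp
    · have him := (lt_of_sv_ne_zero hi).1
      rw [hMB i him i.2, smul_dotProduct, hCC]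
      have : ((⟨i, him⟩ : Fin m) = Fin.castLE hrm j) ↔ i = Fin.castLE hrn j := by
        simp [Fin.ext_iff]
      simp only [this]
      split_ifs with hij
      · rw [hij]; rfl
      · simp
  refine ⟨(C.submatrix (Fin.castLE hrm) id)ᵀ, B.submatrix (Fin.castLE hrn) id, ?_, ?_, ?_, ?_⟩
  · ext i j
    change C _ ⬝ᵥ C _ = _
    rw [hCC, one_apply]
    simp [Fin.ext_iff]
  · ext i j
    change B _ ⬝ᵥ B _ = _
    rw [hBB, one_apply]
    simp [Fin.ext_iff]
  · ext i j
    rw [singularDiag, mul_diagonal, mul_comm]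
    exact congrFun (hMB j (j.2.trans_le hrm) (j.2.trans_le hrn)) i
  · ext i j
    rw [singularDiag, mul_diagonal, mul_comm]
    exact congrFun (hMC j) i

variable {r : ℕ} {A : Matrix (Fin m) (Fin r) ℝ} {B : Matrix (Fin r) (Fin n) ℝ}

/-- Eckart–Young: by Pythagoras the error for `Y` is at least `‖M‖ ^ 2 - ‖M * Qᵀ‖ ^ 2`, and Ky Fan
bounds the subtracted term by its value for the SVD. -/
lemma IsTruncatedSVD.isBestApprox (h : IsTruncatedSVD M A B) :
    IsBestApprox M r (A * singularDiag M r * B) := by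
  refine ⟨(rank_mul_le_right _ _).trans (rank_le_height _), fun Y hY => ?_⟩
  obtain ⟨Q, hQ, hYQ, -⟩ := exists_orthonormal_rows Y
  have h1 : ‖A * singularDiag M r‖ ^ 2 = ∑ i ∈ Finset.range r, sv M i ^ 2 := by
    rw [norm_sq_eq_trace, transpose_mul, Matrix.mul_assoc, ← Matrix.mul_assoc Aᵀ,
      h.left_orthonormal, Matrix.one_mul, singularDiag, diagonal_transpose, diagonal_mul_diagonal,
      trace_diagonal, ← Fin.sum_univ_eq_sum_range (fun i => sv M i ^ 2)]
    simp [sq]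
  have h2 := norm_sq_mul_transpose_le (M := M) hY hQ
  rw [hYQ, norm_sq_sub_mul M _ hQ, norm_sq_sub_mul M _ h.right_orthonormal, h.mul_right, h1]
  simp only [sub_self, norm_zero]
  nlinarith [sq_nonneg ‖M * Qᵀ - Y * Qᵀ‖]

lemma IsTruncatedSVD.gram_mulVec (h : IsTruncatedSVD M A B) (i : Fin r) :
    (Mᵀ * M) *ᵥ B i = sv M i ^ 2 • B i := by
  have h1 : Mᵀ * M * Bᵀ = Bᵀ * (singularDiag M r * singularDiag M r) := by
    rw [Matrix.mul_assoc, h.mul_right, ← Matrix.mul_assoc, h.transpose_mul_left, Matrix.mul_assoc]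
  ext j
  have h2 := congrFun (congrFun h1 j) i
  rw [singularDiag, diagonal_mul_diagonal, mul_diagonal, mul_comm, ← sq] at h2
  exact h2

end TruncatedSVD

lemma exists_isBestApprox {m n : ℕ} (M : Matrix (Fin m) (Fin n) ℝ) (r : ℕ) :
    ∃ X, IsBestApprox M r X := by
  by_cases hr : r ≤ min m n
  · obtain ⟨A, B, h⟩ := exists_isTruncatedSVD M hr
    exact ⟨_, h.isBestApprox⟩
  · refine ⟨M, ?_, fun Y _ => by simp⟩
    exact (le_min (rank_le_height M) (rank_le_width M)).trans (not_le.1 hr).le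

/-! ### First-order structure of best approximations -/

section BestApprox

variable {m n r : ℕ} {M X : Matrix (Fin m) (Fin n) ℝ}

lemma IsBestApprox.transpose (h : IsBestApprox M r X) : IsBestApprox Mᵀ r Xᵀ := by
  refine ⟨by rw [rank_transpose]; exact h.1, fun Y hY => ?_⟩
  have := h.2 Yᵀ (by rwa [rank_transpose])
  rwa [← frobenius_norm_transpose, ← frobenius_norm_transpose (M - Yᵀ), transpose_sub,
    transpose_sub, transpose_transpose] at this

lemma IsBestApprox.eq_mul (h : IsBestApprox M r X) {k : ℕ} (hk : k ≤ r)
    {Q : Matrix (Fin k) (Fin n) ℝ} (hQ : Q * Qᵀ = 1) (hXQ : X = X * Qᵀ * Q) :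
    X = M * Qᵀ * Q := by
  have h1 := h.2 (M * Qᵀ * Q) ((rank_mul_le_right _ _).trans ((rank_le_height _).trans hk))
  rw [hXQ, norm_sq_sub_mul M _ hQ, norm_sq_sub_mul M _ hQ, sub_self, norm_zero] at h1
  have h2 : ‖M * Qᵀ - X * Qᵀ‖ = 0 := by
    have := sq_nonneg ‖M * Qᵀ - X * Qᵀ‖
    exact pow_eq_zero_iff two_ne_zero |>.1 (by linarith)
  rw [norm_eq_zero, sub_eq_zero] at h2
  rw [h2, ← hXQ]

lemma IsBestApprox.mul_transpose_self (h : IsBestApprox M r X) : M * Xᵀ = X * Xᵀ := by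
  obtain ⟨Q, hQ, hXQ, -⟩ := exists_orthonormal_rows X
  have h1 := h.eq_mul h.1 hQ hXQ
  have h2 : (Qᵀ * Q) * (Qᵀ * Q) = Qᵀ * Q := by
    rw [Matrix.mul_assoc, ← Matrix.mul_assoc Q, hQ, Matrix.one_mul]
  rw [h1, Matrix.mul_assoc M, transpose_mul, transpose_mul, transpose_transpose, Matrix.mul_assoc M,
    ← Matrix.mul_assoc (Qᵀ * Q), h2]

lemma IsBestApprox.transpose_mul_self (h : IsBestApprox M r X) : Xᵀ * M = Xᵀ * X := by
  have := congrArg Matrix.transpose h.transpose.mul_transpose_self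
  simpa [transpose_mul] using this

/-- `X` is a projection of `M` both from the right and from the left; together these make `Xᵀ * X`
commute with `Mᵀ * M`. -/
lemma IsBestApprox.gram_mulVec (h : IsBestApprox M r X) {c : ℝ} {v : Fin n → ℝ}
    (hv : (Mᵀ * M) *ᵥ v = c • v) :
    (Mᵀ * M) *ᵥ (Xᵀ *ᵥ (X *ᵥ v)) = c • (Xᵀ *ᵥ (X *ᵥ v)) := by
  have h1 := h.mul_transpose_self
  have h2 := h.transpose_mul_self
  have h3 : X * Mᵀ = X * Xᵀ := by
    have := congrArg Matrix.transpose h1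
    simpa [transpose_mul] using this
  have h4 : Mᵀ * X = Xᵀ * X := by
    have := congrArg Matrix.transpose h2
    simpa [transpose_mul] using this
  have h5 : Mᵀ * M * (Xᵀ * X) = Xᵀ * X * (Mᵀ * M) := by
    calc Mᵀ * M * (Xᵀ * X) = Mᵀ * (M * Xᵀ) * X := by simp only [Matrix.mul_assoc]
      _ = (Mᵀ * X) * Xᵀ * X := by rw [h1]; simp only [Matrix.mul_assoc]
      _ = Xᵀ * X * (Xᵀ * M) := by rw [h4, h2]; simp only [Matrix.mul_assoc]
      _ = Xᵀ * (X * Mᵀ) * M := by rw [h3]; simp only [Matrix.mul_assoc]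
      _ = _ := by simp only [Matrix.mul_assoc]
  rw [mulVec_mulVec v Xᵀ X, mulVec_mulVec, h5, ← mulVec_mulVec, hv, mulVec_smul]

/-- A best approximation of rank at most `r ≥ 1` does not annihilate a Perron vector. -/
lemma IsBestApprox.mulVec_ne_zero (h : IsBestApprox M r X) (hr : 1 ≤ r) {c : ℝ} (hc : 0 < c)
    {v : Fin n → ℝ} (hv1 : v ⬝ᵥ v = 1) (hv : (Mᵀ * M) *ᵥ v = c • v)
    (hlt : ∀ w, w ≠ 0 → w ⬝ᵥ v = 0 → w ⬝ᵥ (Mᵀ * M) *ᵥ w < c * (w ⬝ᵥ w)) :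
    X *ᵥ v ≠ 0 := by
  intro h0
  have hMv : (M *ᵥ v) ⬝ᵥ (M *ᵥ v) = c := by
    rw [← dotProduct_gram, hv, dotProduct_smul, hv1, smul_eq_mul, mul_one]
  have hopt : ∀ {k : ℕ}, k ≤ r → ∀ {Q : Matrix (Fin k) (Fin n) ℝ}, Q * Qᵀ = 1 →
      ‖M - X‖ ^ 2 ≤ ‖M‖ ^ 2 - ‖M * Qᵀ‖ ^ 2 := by
    intro k hk Q hQ
    have := h.2 (M * Qᵀ * Q) ((rank_mul_le_right _ _).trans ((rank_le_height _).trans hk))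
    rwa [norm_sq_sub_mul M _ hQ, sub_self, norm_zero, zero_pow two_ne_zero, add_zero] at this
  obtain ⟨Q, hQ, hXQ, W, hW⟩ := exists_orthonormal_rows X
  have hXM := h.eq_mul h.1 hQ hXQ
  have hMX : ‖M - X‖ ^ 2 = ‖M‖ ^ 2 - ‖M * Qᵀ‖ ^ 2 := by
    conv_lhs => rw [hXM]
    rw [norm_sq_sub_mul M _ hQ, sub_self, norm_zero, zero_pow two_ne_zero, add_zero]
  have hQv : ∀ i, Q i ⬝ᵥ v = 0 := fun i => by
    have : Q *ᵥ v = 0 := by rw [hW, ← mulVec_mulVec, h0, mulVec_zero]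
    exact congrFun this i
  have hQQ : ∀ i j, Q i ⬝ᵥ Q j = if i = j then 1 else 0 := fun i j => by
    rw [← one_apply, ← hQ]
    rfl
  -- With no row to exchange, the rank-one projection of `M` onto `v` already beats `X = 0`.
  rcases Nat.eq_zero_or_pos X.rank with hk | hk
  · have hv2 : (of fun _ : Fin 1 => v) * (of fun _ : Fin 1 => v)ᵀ = 1 := by
      ext i j
      rw [Subsingleton.elim i j, one_apply_eq]
      exact hv1
    have h1 := hopt hr hv2
    have : IsEmpty (Fin X.rank) := by rw [hk]; infer_instance
    rw [hMX, norm_sq_mul_transpose, norm_sq_mul_transpose, Fin.sum_univ_one,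
      Finset.univ_eq_empty, Finset.sum_empty] at h1
    change _ ≤ _ - (M *ᵥ v) ⬝ᵥ (M *ᵥ v) at h1
    linarith
  · let i₀ : Fin X.rank := ⟨0, hk⟩
    -- Since `v` is orthogonal to the rows of `Q`, the exchange keeps orthonormality, and it
    -- strictly increases the captured norm by `hlt`.
    set Q' : Matrix (Fin X.rank) (Fin n) ℝ := Q.updateRow i₀ v
    have hself : Q' i₀ = v := updateRow_self
    have hne : ∀ {i}, i ≠ i₀ → Q' i = Q i := updateRow_ne
    have hQ' : Q' * Q'ᵀ = 1 := by
      ext i j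
      change Q' i ⬝ᵥ Q' j = _
      rw [one_apply]
      by_cases hi : i = i₀ <;> by_cases hj : j = i₀
      · rw [hi, hj, hself, hv1, if_pos rfl]
      · rw [hi, hself, hne hj, dotProduct_comm, hQv, if_neg (Ne.symm hj)]
      · rw [hj, hself, hne hi, hQv, if_neg hi]
      · rw [hne hi, hne hj, hQQ]
    have h1 := hopt h.1 hQ'
    rw [hMX, norm_sq_mul_transpose, norm_sq_mul_transpose,
      ← Finset.add_sum_erase _ _ (Finset.mem_univ i₀),
      ← Finset.add_sum_erase _ _ (Finset.mem_univ i₀)] at h1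
    have h2 : ∑ i ∈ Finset.univ.erase i₀, (M *ᵥ Q' i) ⬝ᵥ (M *ᵥ Q' i) =
        ∑ i ∈ Finset.univ.erase i₀, (M *ᵥ Q i) ⬝ᵥ (M *ᵥ Q i) := by
      refine Finset.sum_congr rfl fun i hi => ?_
      rw [hne (Finset.ne_of_mem_erase hi)]
    rw [h2, hself, hMv, ← dotProduct_gram] at h1
    have h4 := hQQ i₀ i₀
    rw [if_pos rfl] at h4
    have h5 : Q i₀ ≠ 0 := fun e => by
      rw [e, zero_dotProduct] at h4
      exact zero_ne_one h4
    have h6 := hlt _ h5 (hQv i₀)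
    rw [h4] at h6
    linarith

end BestApprox

/-! ### A positive vector in the row space -/

section PositiveVector

variable {m n r : ℕ} {M X : Matrix (Fin m) (Fin n) ℝ}

lemma gram_transpose : (Mᵀ * M)ᵀ = Mᵀ * M := by
  rw [transpose_mul, transpose_transpose]

lemma gram_nonneg (hM : ∀ i j, 0 ≤ M i j) (i j : Fin n) : 0 ≤ (Mᵀ * M) i j := by
  rw [mul_apply]
  exact Finset.sum_nonneg fun k _ => mul_nonneg (hM k i) (hM k j)

lemma sv_zero_sq_pos (hM0 : M ≠ 0) : 0 < sv M 0 ^ 2 := by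
  refine lt_of_le_of_ne (sq_nonneg _) fun h => hM0 ?_
  refine ext_of_mulVec_single fun i => ?_
  have := rayleigh_le (M := M) (Pi.single i 1)
  rw [← h, zero_mul, dotProduct_gram] at this
  have h0 : (M *ᵥ Pi.single i 1) ⬝ᵥ (M *ᵥ Pi.single i 1) = 0 :=
    le_antisymm this (Finset.sum_nonneg fun a _ => mul_self_nonneg _)
  rw [dotProduct_self_eq_zero.1 h0, zero_mulVec]

lemma exists_perron_vector (hM : ∀ i j, 0 ≤ M i j) (hirr : IsIrreducible (Mᵀ * M)) (hn : 0 < n) :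
    ∃ v : Fin n → ℝ, (∀ i, 0 < v i) ∧ v ⬝ᵥ v = 1 ∧ (Mᵀ * M) *ᵥ v = sv M 0 ^ 2 • v := by
  obtain ⟨B, hB, h⟩ := exists_right_singular_basis M
  have hG := h ⟨0, hn⟩
  have h1 : B ⟨0, hn⟩ ⬝ᵥ B ⟨0, hn⟩ = 1 := by
    have : B ⟨0, hn⟩ ⬝ᵥ B ⟨0, hn⟩ = (B * Bᵀ) ⟨0, hn⟩ ⟨0, hn⟩ := rfl
    rw [this, hB, one_apply_eq]
  refine ⟨|B ⟨0, hn⟩|, ?_, ?_, ?_⟩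
  · refine abs_pos_of_mulVec_eq gram_transpose (gram_nonneg hM) hirr rayleigh_le ?_ hG
    intro h0
    rw [h0, zero_dotProduct] at h1
    exact zero_ne_one h1
  · rw [← h1]
    simp [dotProduct]
  · exact mulVec_abs_eq gram_transpose (gram_nonneg hM) rayleigh_le hG

lemma IsBestApprox.exists_vecMul_pos (h : IsBestApprox M r X) (hM : ∀ i j, 0 ≤ M i j)
    (hirr : IsIrreducible (Mᵀ * M)) (hr : 1 ≤ r) (hM0 : M ≠ 0) :
    ∃ z : Fin m → ℝ, ∀ j, 0 < (z ᵥ* X) j := by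
  rcases n.eq_zero_or_pos with rfl | hn
  · exact ⟨0, fun j => j.elim0⟩
  obtain ⟨v, hvpos, hv1, hGv⟩ := exists_perron_vector hM hirr hn
  have hXv : X *ᵥ v ≠ 0 := h.mulVec_ne_zero hr (sv_zero_sq_pos hM0) hv1 hGv fun w hw hwv =>
    rayleigh_lt_of_dotProduct_eq_zero gram_transpose (gram_nonneg hM) hirr rayleigh_le hvpos hGv
      hw hwv
  have hu : Xᵀ *ᵥ (X *ᵥ v) ≠ 0 := fun h0 => hXv <| by
    rw [← dotProduct_self_eq_zero, ← dotProduct_gram, ← mulVec_mulVec, h0, dotProduct_zero]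
  rcases pos_or_neg_of_mulVec_eq gram_transpose (gram_nonneg hM) hirr rayleigh_le hu
    (h.gram_mulVec hGv) with hp | hneg
  · exact ⟨X *ᵥ v, fun j => by rw [← mulVec_transpose]; exact hp j⟩
  · refine ⟨-(X *ᵥ v), fun j => ?_⟩
    rw [← mulVec_transpose, mulVec_neg]
    exact neg_pos.2 (hneg j)

end PositiveVector

/-! ### Nonnegative factors from a positive vector -/

section Factorization

lemma exists_mul_add_vecMulVec_eq {k n : ℕ} (Q : Matrix (Fin k) (Fin n) ℝ) {y a : Fin k → ℝ}
    (h : 1 + y ⬝ᵥ a ≠ 0) :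
    ∃ N : Matrix (Fin k) (Fin k) ℝ, N * (Q + vecMulVec a (y ᵥ* Q)) = Q := by
  -- The Sherman–Morrison inverse of `1 + vecMulVec a y`.
  refine ⟨1 - (1 + y ⬝ᵥ a)⁻¹ • vecMulVec a y, ?_⟩
  have h1 : vecMulVec a y * vecMulVec a (y ᵥ* Q) = (y ⬝ᵥ a) • vecMulVec a (y ᵥ* Q) := by
    rw [vecMulVec_mul_vecMulVec]
    ext i j
    simp [vecMulVec_apply]
    ring
  have h2 : vecMulVec a y * Q = vecMulVec a (y ᵥ* Q) := vecMulVec_mul _ _ _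
  rw [Matrix.sub_mul, Matrix.one_mul, smul_mul, Matrix.mul_add, h1, h2]
  ext i j
  simp only [Matrix.sub_apply, Matrix.add_apply, Matrix.smul_apply, smul_eq_mul]
  field_simp
  ring

lemma exists_nonneg_factor_of_pos {m k n : ℕ} (Z : Matrix (Fin m) (Fin k) ℝ)
    (Q : Matrix (Fin k) (Fin n) ℝ) {y : Fin k → ℝ} (hy : ∀ j, 0 < (y ᵥ* Q) j) :
    ∃ (U : Matrix (Fin m) (Fin k) ℝ) (V : Matrix (Fin k) (Fin n) ℝ),
      (∀ i j, 0 ≤ V i j) ∧ Z * Q = U * V := by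
  set x := y ᵥ* Q with hx
  set t₀ : ℝ := ∑ i, ∑ j, |Q i j| / x j with ht₀
  -- The expression is affine in `t` with value `1` at `0`, so it cannot vanish at both `t₀` and `t₀
  -- + 1`.
  obtain ⟨t, ht, hne⟩ : ∃ t, t₀ ≤ t ∧ 1 + y ⬝ᵥ (fun _ => t) ≠ 0 := by
    have hdot : ∀ t : ℝ, y ⬝ᵥ (fun _ => t) = (∑ i, y i) * t := fun t => by
      simp [dotProduct, Finset.sum_mul]
    by_cases h0 : 1 + y ⬝ᵥ (fun _ => t₀) = 0
    · refine ⟨t₀ + 1, by linarith, fun h1 => ?_⟩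
      rw [hdot] at h0 h1
      have : ∑ i, y i = 0 := by linarith
      rw [this] at h0
      linarith
    · exact ⟨t₀, le_rfl, h0⟩
  obtain ⟨N, hN⟩ := exists_mul_add_vecMulVec_eq Q hne
  refine ⟨Z * N, Q + vecMulVec (fun _ => t) x, fun i j => ?_, ?_⟩
  · have h1 : |Q i j| / x j ≤ t₀ := by
      have hnn : ∀ a b, 0 ≤ |Q a b| / x b := fun a b => div_nonneg (abs_nonneg _) (hy b).le
      calc |Q i j| / x j ≤ ∑ b, |Q i b| / x b :=
            Finset.single_le_sum (f := fun b => |Q i b| / x b) (fun b _ => hnn i b)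
              (Finset.mem_univ j)
        _ ≤ t₀ := Finset.single_le_sum (f := fun a => ∑ b, |Q a b| / x b)
              (fun a _ => Finset.sum_nonneg fun b _ => hnn a b) (Finset.mem_univ i)
    rw [div_le_iff₀ (hy j)] at h1
    rw [Matrix.add_apply, vecMulVec_apply]
    nlinarith [neg_abs_le (Q i j), mul_le_mul_of_nonneg_right ht (hy j).le]
  · rw [Matrix.mul_assoc, hN]

lemma exists_nonneg_factor_rank {m n : ℕ} {X : Matrix (Fin m) (Fin n) ℝ}
    (h : X = 0 ∨ ∃ z : Fin m → ℝ, ∀ j, 0 < (z ᵥ* X) j) :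
    ∃ (U : Matrix (Fin m) (Fin X.rank) ℝ) (V : Matrix (Fin X.rank) (Fin n) ℝ),
      (∀ i j, 0 ≤ V i j) ∧ X = U * V := by
  rcases h with h | ⟨z, hz⟩
  · exact ⟨0, 0, fun _ _ => le_rfl, by rw [Matrix.zero_mul, h]⟩
  · obtain ⟨Q, -, hXQ, -⟩ := exists_orthonormal_rows X
    obtain ⟨U, V, hV, hUV⟩ := exists_nonneg_factor_of_pos (X * Qᵀ) Q (y := z ᵥ* (X * Qᵀ))
      (by rwa [vecMul_vecMul, ← hXQ])
    exact ⟨U, V, hV, hXQ.trans hUV⟩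

lemma isSemiNonneg_of_factor {m n : ℕ} {X : Matrix (Fin m) (Fin n) ℝ}
    {U : Matrix (Fin m) (Fin X.rank) ℝ} {V : Matrix (Fin X.rank) (Fin n) ℝ}
    (hV : ∀ i j, 0 ≤ V i j) (hX : X = U * V) : IsSemiNonneg X := by
  refine le_antisymm (le_csInf ⟨_, U, V, hV, hX⟩ ?_) (Nat.sInf_le ⟨U, V, hV, hX⟩)
  rintro k ⟨U', V', -, hX'⟩
  rw [hX']
  exact (rank_mul_le_right _ _).trans (rank_le_height _)

lemma exists_nonneg_factor_of_le {m n k r : ℕ} (hkr : k ≤ r) (U : Matrix (Fin m) (Fin k) ℝ)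
    {V : Matrix (Fin k) (Fin n) ℝ} (hV : ∀ i j, 0 ≤ V i j) :
    ∃ (U' : Matrix (Fin m) (Fin r) ℝ) (V' : Matrix (Fin r) (Fin n) ℝ),
      (∀ i j, 0 ≤ V' i j) ∧ U * V = U' * V' := by
  -- Pads with zero columns and zero rows.
  let E : Matrix (Fin k) (Fin r) ℝ := (1 : Matrix (Fin r) (Fin r) ℝ).submatrix (Fin.castLE hkr) id
  have hE : E * Eᵀ = 1 := by
    ext i j
    simp [E, mul_apply, one_apply]
  refine ⟨U * E, Eᵀ * V, fun i j => ?_, ?_⟩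
  · rw [mul_apply]
    refine Finset.sum_nonneg fun a _ => mul_nonneg ?_ (hV a j)
    simp only [E, transpose_apply, submatrix_apply, one_apply]
    split_ifs <;> simp
  · rw [Matrix.mul_assoc, ← Matrix.mul_assoc E, hE, Matrix.one_mul]

variable {m n r : ℕ} {M X : Matrix (Fin m) (Fin n) ℝ}

lemma IsBestApprox.isSolution (h : IsBestApprox M r X) {U : Matrix (Fin m) (Fin r) ℝ}
    {V : Matrix (Fin r) (Fin n) ℝ} (hV : ∀ i j, 0 ≤ V i j)
    (hUV : ‖M - U * V‖ ^ 2 ≤ ‖M - X‖ ^ 2) : IsSolution M U V :=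
  ⟨hV, fun U' V' _ => hUV.trans
    (h.2 _ ((rank_mul_le_right U' V').trans (rank_le_height V')))⟩

lemma IsBestApprox.eq_zero (h : IsBestApprox M r X) (h0 : ¬(1 ≤ r ∧ M ≠ 0)) : X = 0 := by
  by_cases hr : 1 ≤ r
  · have hM : M = 0 := by_contra fun hM => h0 ⟨hr, hM⟩
    have h1 := h.2 0 (by simp)
    rw [hM] at h1
    simpa using h1
  · have hk : X.rank = 0 := by
      have := h.1
      omega
    obtain ⟨Q, -, hXQ, -⟩ := exists_orthonormal_rows X
    have : IsEmpty (Fin X.rank) := by rw [hk]; infer_instance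
    rw [hXQ, Subsingleton.elim Q 0, Matrix.mul_zero]

end Factorization

/-! ### The explicit shift for truncated SVDs -/

section Shift

variable {r n : ℕ} (B : Matrix (Fin r) (Fin n) ℝ)

lemma exists_signFlip_eq : ∃ D : Matrix (Fin r) (Fin r) ℝ, B = D * signFlip B := by
  classical
  refine ⟨diagonal fun i => if (⨅ k, B i k) ≤ (⨅ k, -B i k) then -1 else 1, ?_⟩
  ext i j
  rw [diagonal_mul, signFlip, of_apply]
  split_ifs <;> simp

lemma signFlip_pos {i : Fin r} (h : (∀ j, 0 < B i j) ∨ ∀ j, B i j < 0) (j : Fin n) :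
    0 < signFlip B i j := by
  have : Nonempty (Fin n) := ⟨j⟩
  rw [signFlip, of_apply]
  rcases h with h | h
  · rw [if_neg]
    · exact h j
    · rw [not_le]
      obtain ⟨a, ha⟩ := exists_eq_ciInf_of_finite (f := fun k => B i k)
      rw [← ha]
      exact (ciInf_le (Set.finite_range _).bddBelow j).trans_lt ((neg_neg_of_pos (h j)).trans (h a))
  · rw [if_pos]
    · exact neg_pos.2 (h j)
    · refine le_ciInf fun a => (ciInf_le (Set.finite_range _).bddBelow j).trans ?_
      exact ((h j).trans (neg_pos.2 (h a))).le

variable {B} {y : Fin r → ℝ}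

lemma shifted_nonneg (hy : ∀ j, 1 ≤ (y ᵥ* B) j) (i : Fin r) (j : Fin n) :
    0 ≤ shifted B y i j := by
  have hx : 0 < (y ᵥ* B) j := zero_lt_one.trans_le (hy j)
  have h1 : -B i j / (y ᵥ* B) j ≤ shift B y i :=
    (le_ciSup (f := fun j => -B i j / (y ᵥ* B) j) (Set.finite_range _).bddAbove j).trans
      (le_max_right _ _)
  rw [div_le_iff₀ hx] at h1
  rw [shifted, Matrix.add_apply, vecMulVec_apply]
  linarith

lemma exists_shift_of_pos {i : Fin r} (h : ∀ j, 0 < B i j) :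
    ∃ y : Fin r → ℝ, (∀ j, 1 ≤ (y ᵥ* B) j) ∧ 1 + y ⬝ᵥ shift B y ≠ 0 := by
  -- A scale for row `i` that brings every entry to at least `1`; as `t` and the shift are
  -- nonnegative, `1 + y ⬝ᵥ shift B y ≥ 1`.
  set t : ℝ := ∑ j, (B i j)⁻¹ with ht
  have ht0 : 0 ≤ t := Finset.sum_nonneg fun j _ => (inv_pos.2 (h j)).le
  have hx : ∀ j, (Pi.single i t ᵥ* B) j = t * B i j := fun j => by
    simp
  have hx1 : ∀ j, 1 ≤ t * B i j := fun j => by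
    have : (B i j)⁻¹ ≤ t := Finset.single_le_sum (f := fun j => (B i j)⁻¹)
      (fun j _ => (inv_pos.2 (h j)).le) (Finset.mem_univ j)
    calc 1 = (B i j)⁻¹ * B i j := (inv_mul_cancel₀ (h j).ne').symm
      _ ≤ t * B i j := mul_le_mul_of_nonneg_right this (h j).le
  refine ⟨Pi.single i t, fun j => by rw [hx]; exact hx1 j, ?_⟩
  have : 0 ≤ t * shift B (Pi.single i t) i := mul_nonneg ht0 (le_max_left _ _)
  rw [single_dotProduct]
  linarith

end Shift

lemma IsTruncatedSVD.exists_shift {m n r : ℕ} {M : Matrix (Fin m) (Fin n) ℝ}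
    {A : Matrix (Fin m) (Fin r) ℝ} {B : Matrix (Fin r) (Fin n) ℝ} (h : IsTruncatedSVD M A B)
    (hM : ∀ i j, 0 ≤ M i j) (hirr : IsIrreducible (Mᵀ * M)) (hr : 1 ≤ r) :
    ∃ y : Fin r → ℝ, (∀ j, 1 ≤ (y ᵥ* signFlip B) j) ∧
      1 + y ⬝ᵥ shift (signFlip B) y ≠ 0 := by
  let i : Fin r := ⟨0, hr⟩
  refine exists_shift_of_pos (i := i) (signFlip_pos B ?_)
  -- Row `0` of `B` belongs to the top eigenvalue, so it has one strict sign and the flip makes it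
  -- positive.
  refine pos_or_neg_of_mulVec_eq gram_transpose (gram_nonneg hM) hirr rayleigh_le ?_
    (h.gram_mulVec i)
  intro h0
  have h1 : B i ⬝ᵥ B i = (B * Bᵀ) i i := rfl
  rw [h0, zero_dotProduct, h.right_orthonormal, one_apply_eq] at h1
  exact zero_ne_one h1

lemma exists_mul_shifted {m n r : ℕ} {M : Matrix (Fin m) (Fin n) ℝ}
    (A : Matrix (Fin m) (Fin r) ℝ) (B : Matrix (Fin r) (Fin n) ℝ) {y : Fin r → ℝ}
    (hy : 1 + y ⬝ᵥ shift (signFlip B) y ≠ 0) :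
    ∃ U : Matrix (Fin m) (Fin r) ℝ,
      U * shifted (signFlip B) y = A * singularDiag M r * B := by
  obtain ⟨D, hD⟩ := exists_signFlip_eq B
  obtain ⟨N, hN⟩ := exists_mul_add_vecMulVec_eq (signFlip B) hy
  refine ⟨A * singularDiag M r * D * N, ?_⟩
  rw [shifted, Matrix.mul_assoc, hN, Matrix.mul_assoc, ← hD]

end SemiNMF

theorem mainTheorem7 {m n : ℕ} (M : Matrix (Fin m) (Fin n) ℝ)
    (hM : ∀ i j, 0 ≤ M i j) (hirr : SemiNMF.IsIrreducible (Mᵀ * M)) (r : ℕ) :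
    -- best rank-`r` approximations exist; each of them contains a positive vector in its row
    -- space, is semi-nonnegative, and factors into an optimal semi-NMF of `M`
    (∃ X, SemiNMF.IsBestApprox M r X) ∧
    (∀ X, SemiNMF.IsBestApprox M r X →
      (1 ≤ r → M ≠ 0 → ∃ z : Fin m → ℝ, ∀ j, 0 < (z ᵥ* X) j) ∧
      SemiNMF.IsSemiNonneg X ∧
      ∃ (U : Matrix (Fin m) (Fin r) ℝ) (V : Matrix (Fin r) (Fin n) ℝ),
        X = U * V ∧ SemiNMF.IsSolution M U V) ∧
    -- truncated SVDs exist, and each of them yields an optimal semi-NMF of `M`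
    (r ≤ min m n → ∃ (A : Matrix (Fin m) (Fin r) ℝ) (B : Matrix (Fin r) (Fin n) ℝ),
      SemiNMF.IsTruncatedSVD M A B) ∧
    (∀ (A : Matrix (Fin m) (Fin r) ℝ) (B : Matrix (Fin r) (Fin n) ℝ),
      SemiNMF.IsTruncatedSVD M A B →
      SemiNMF.IsBestApprox M r (A * SemiNMF.singularDiag M r * B) ∧
      (1 ≤ r → ∃ y : Fin r → ℝ, (∀ j, 1 ≤ (y ᵥ* SemiNMF.signFlip B) j) ∧
        1 + y ⬝ᵥ SemiNMF.shift (SemiNMF.signFlip B) y ≠ 0) ∧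
      ∀ y : Fin r → ℝ, (∀ j, 1 ≤ (y ᵥ* SemiNMF.signFlip B) j) →
        1 + y ⬝ᵥ SemiNMF.shift (SemiNMF.signFlip B) y ≠ 0 →
        (∃ U : Matrix (Fin m) (Fin r) ℝ,
          U * SemiNMF.shifted (SemiNMF.signFlip B) y = A * SemiNMF.singularDiag M r * B) ∧
        ∀ U : Matrix (Fin m) (Fin r) ℝ,
          (∀ U' : Matrix (Fin m) (Fin r) ℝ,
            ‖M - U * SemiNMF.shifted (SemiNMF.signFlip B) y‖ ^ 2 ≤
              ‖M - U' * SemiNMF.shifted (SemiNMF.signFlip B) y‖ ^ 2) →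
          SemiNMF.IsSolution M U (SemiNMF.shifted (SemiNMF.signFlip B) y)) := by
  refine ⟨SemiNMF.exists_isBestApprox M r, fun X hX => ?_,
    fun hr => SemiNMF.exists_isTruncatedSVD M hr, fun A B h => ?_⟩
  · have hpos := fun hr hM0 => hX.exists_vecMul_pos hM hirr hr hM0
    have hcases : X = 0 ∨ ∃ z : Fin m → ℝ, ∀ j, 0 < (z ᵥ* X) j := by
      by_cases h0 : 1 ≤ r ∧ M ≠ 0
      · exact Or.inr (hpos h0.1 h0.2)
      · exact Or.inl (hX.eq_zero h0)
    obtain ⟨U, V, hV, hUV⟩ := SemiNMF.exists_nonneg_factor_rank hcases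
    obtain ⟨U', V', hV', hUV'⟩ := SemiNMF.exists_nonneg_factor_of_le hX.1 U hV
    have hXUV := hUV.trans hUV'
    exact ⟨hpos, SemiNMF.isSemiNonneg_of_factor hV hUV, U', V', hXUV,
      hX.isSolution hV' (by rw [← hXUV])⟩
  · refine ⟨h.isBestApprox, h.exists_shift hM hirr, fun y hy hne => ?_⟩
    obtain ⟨U₀, hU₀⟩ := SemiNMF.exists_mul_shifted (M := M) A B hne
    refine ⟨⟨U₀, hU₀⟩, fun U hU => h.isBestApprox.isSolution (SemiNMF.shifted_nonneg hy) ?_⟩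
    rw [← hU₀]
    exact hU U₀
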